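/- Let $\mathbb T=\mathbb R/2\pi\mathbb Z$, and let $H$ be the periodic Hilbert transform $$H\varpi(\alpha)=\frac1\pi\,\mathrm{PV}\!\int_{-\pi}^{\pi}\frac{\varpi(\beta)}{2\tan((\alpha-\beta)/2)}\,d\beta .$$ For $s>3/2$ and $T>0$, a solution in $C([0,T);H^s(\mathbb T))$ of $$\varpi_t-\tfrac12(\varpi H\varpi)_\sigma=0,\qquad \varpi(\cdot,0)=\varpi_0, \tag{1}$$ is a real-valued $\varpi\in C([0,T);H^s(\mathbb T))$ with $\varpi(\cdot,0)=\varpi_0$ that satisfies the equation in the sense of distributions: for every $\varphi\in C^\infty(\mathbb T)$ and every $t\in(0,T)$, $$\frac{d}{dt}\int_{\mathbb T}\varpi(\sigma,t)\,\varphi(\sigma)\,d\sigma=-\frac12\int_{\mathbb T}\varpi(\sigma,t)\,H\varpi(\sigma,t)\,\varphi'(\sigma)\,d\sigma .$$ (Elements of $H^s(\mathbb T)$, $s>3/2$, are identified with their continuous representatives.) (i) Let $s>3/2$ and let $\varpi_0\in H^s(\mathbb T)$ be real-valued with $\int_{\mathbb T}\varpi_0=0$. Suppose that there is a point $\sigma_0$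 with $\varpi_0(\sigma_0)>0$ such that $\varpi_0$ is not $C^\infty$ at $\sigma_0$, that is, $\varpi_0$ is not of class $C^\infty$ on any neighbourhood of $\sigma_0$. Then for every $T>0$ problem (1) has no solution in $C([0,T);H^s(\mathbb T))$. (ii) Smoothness of the initial datum is not sufficient for existence: there is a real-valued $\varpi_0\in C^\infty(\mathbb T)$ with $\int_{\mathbb T}\varpi_0=0$ such that, for every $s>3/2$ and every $T>0$, problem (1) has no solution in $C([0,T);H^s(\mathbb T))$. -/

import Mathlib

open Real Set Filter Topology MeasureTheory
open scoped ContDiff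

noncomputable section

/-- Membership of `f` in the Sobolev space `H^s(𝕋)`, `𝕋 = ℝ / 2πℤ`, for `s > 1/2`. Functions on `𝕋` are
`2π`-periodic functions on the line. Since `s > 1/2`, every class in `H^s(𝕋)` has exactly one
continuous representative, and `f` is that representative. -/
structure MemPeriodicSobolev (s : ℝ) (f : ℝ → ℝ) : Prop where
  periodic : Function.Periodic f (2 * π)
  continuous : Continuous f
  summable : Summable fun n : ℤ =>
    (1 + (n : ℝ) ^ 2) ^ s * ‖fourierCoeffOn Real.two_pi_pos (fun x => (f x : ℂ)) n‖ ^ 2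

/-- The norm of `H^s(𝕋)`: `‖f‖² = ∑ₙ (1 + n²)^s |f̂(n)|²`. -/
def periodicSobolevNorm (s : ℝ) (f : ℝ → ℝ) : ℝ :=
  √(∑' n : ℤ,
    (1 + (n : ℝ) ^ 2) ^ s * ‖fourierCoeffOn Real.two_pi_pos (fun x => (f x : ℂ)) n‖ ^ 2)

/-- The class `C([0,T); H^s(𝕋))`, `s > 1/2`. -/
structure ContinuousIntoPeriodicSobolev (s T : ℝ) (w : ℝ → ℝ → ℝ) : Prop where
  mem : ∀ t ∈ Ico 0 T, MemPeriodicSobolev s (w t)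
  tendsto : ∀ t₀ ∈ Ico 0 T,
    Tendsto (fun t => periodicSobolevNorm s (fun x => w t x - w t₀ x)) (𝓝[Ico 0 T] t₀) (𝓝 0)

/-- The periodic Hilbert transform
`Hf(α) = (1/π) PV ∫ f(β) / (2 tan((α-β)/2)) dβ`,
the integral being over one period, centred at `α`, with `|α - β| ≤ ε` removed and `ε → 0⁺`.
The limit exists for every periodic `f` of class `C¹`, in particular on `H^s(𝕋)`, `s > 3/2`. -/
def periodicHilbert (f : ℝ → ℝ) (α : ℝ) : ℝ :=
  limUnder (𝓝[>] (0 : ℝ)) fun ε =>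
    1 / π * ∫ β in {β : ℝ | ε < |α - β| ∧ |α - β| ≤ π}, f β / (2 * tan ((α - β) / 2))

/-- `w` is a solution on `[0,T)`, in the class `C([0,T); H^s(𝕋))`, of
`w_t - (1/2) (w H w)_σ = 0`, `w(·,0) = w₀`. The equation is understood in the sense of
distributions in `σ`, i.e. for every smooth periodic `φ` and every `0 < t < T`,
`d/dt ∫ w φ = -(1/2) ∫ (w H w) φ'`. -/
structure IsAmplitudeSolution (s T : ℝ) (w₀ : ℝ → ℝ) (w : ℝ → ℝ → ℝ) : Prop where
  class_mem : ContinuousIntoPeriodicSobolev s T w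
  initial : w 0 = w₀
  equation : ∀ φ : ℝ → ℝ, ContDiff ℝ ∞ φ → Function.Periodic φ (2 * π) → ∀ t ∈ Ioo 0 T,
    HasDerivAt (fun τ => ∫ σ in (0 : ℝ)..2 * π, w τ σ * φ σ)
      (-(1 / 2) * ∫ σ in (0 : ℝ)..2 * π, w t σ * periodicHilbert (w t) σ * deriv φ σ) t

end

/-!
The equation is a complex Burgers equation in disguise. For a mean-zero function `w` on the circle,
`F = w + i H w` consists of the boundary values of a holomorphic function in the unit disc, and
`w H w = Im (F²) / 2`. Taking positive Fourier modes, `w_t = ½ (w H w)_σ` becomes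
`∂ₜ F = ¼ ζ ∂_ζ (F²) = ½ F ζ ∂_ζ F` in the disc. Hence `F` is constant along the characteristics
`ζ(t) = ζ₀ exp (-t F(0, ζ₀) / 2)`, and these enter the open disc exactly from those points `ζ₀` of
the circle at which `w₀ = Re F(0, ·)` is positive
(`IsDiscSolution.powerSum_characteristic`).

So the initial value at such a point is the value of `F(t, ·)` at an interior point, where `F(t, ·)`
is holomorphic. The interior position depends analytically on the starting point, because the
backward flow `p ↦ p exp (t F(t, p) / 2)` is holomorphic and locally invertible
(`IsDiscSolution.analyticAt`). Therefore a mean-zero datum that admits a solution is real-analytic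
wherever it is positive (`IsAmplitudeSolution.analyticAt_of_pos`). The first claim follows at once,
and the second follows by taking a smooth datum that is not analytic at a point where it is positive
(`flatDatum`).

The disc is handled through power series. The weak formulation tested with `cos (n σ)` and
`sin (n σ)` gives the triangular system `aₙ' = (n / 4) ∑_{k + l = n} aₖ aₗ` for `aₙ = 2 ŵ(n)`, and
for `s > 3/2` the Sobolev norm controls `∑ (1 + n) |aₙ|`, which gives all the convergence needed up to
the circle. The identity `H (Re F) = Im F` is obtained from the principal value by folding the
integral about its centre and integrating termwise (`periodicHilbert_re_powerSum`).
-/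

/-! ### Power series on the closed unit disc -/

/-- The sum `∑ aₙ ζⁿ` of a power series, considered on the closed unit disc. -/
noncomputable def powerSum (a : ℕ → ℂ) (ζ : ℂ) : ℂ := ∑' n, a n * ζ ^ n

/-- The coefficients of the square of a power series. -/
noncomputable def squareCoeff (a : ℕ → ℂ) (n : ℕ) : ℂ :=
  ∑ kl ∈ Finset.HasAntidiagonal.antidiagonal n, a kl.1 * a kl.2

lemma norm_mul_pow_le {c ζ : ℂ} (hζ : ‖ζ‖ ≤ 1) (n : ℕ) : ‖c * ζ ^ n‖ ≤ ‖c‖ := by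
  rw [norm_mul, norm_pow]
  exact mul_le_of_le_one_right (norm_nonneg _) (pow_le_one₀ (norm_nonneg _) hζ)

lemma summable_norm_mul_pow {a : ℕ → ℂ} (ha : Summable fun n => ‖a n‖) {ζ : ℂ} (hζ : ‖ζ‖ ≤ 1) :
    Summable fun n => ‖a n * ζ ^ n‖ :=
  ha.of_nonneg_of_le (fun _ => norm_nonneg _) fun n => norm_mul_pow_le hζ n

lemma norm_powerSum_le {a : ℕ → ℂ} (ha : Summable fun n => ‖a n‖) {ζ : ℂ} (hζ : ‖ζ‖ ≤ 1) :
    ‖powerSum a ζ‖ ≤ ∑' n, ‖a n‖ :=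
  (norm_tsum_le_tsum_norm (summable_norm_mul_pow ha hζ)).trans
    ((summable_norm_mul_pow ha hζ).tsum_le_tsum (fun n => norm_mul_pow_le hζ n) ha)

lemma norm_powerSum_sub_le {a b : ℕ → ℂ} (ha : Summable fun n => ‖a n‖)
    (hb : Summable fun n => ‖b n‖) {ζ : ℂ} (hζ : ‖ζ‖ ≤ 1) :
    ‖powerSum a ζ - powerSum b ζ‖ ≤ ∑' n, ‖a n - b n‖ := by
  have h : Summable fun n => ‖a n - b n‖ :=
    (ha.add hb).of_nonneg_of_le (fun _ => norm_nonneg _) fun n => norm_sub_le _ _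
  have : powerSum a ζ - powerSum b ζ = powerSum (fun n => a n - b n) ζ := by
    simp only [powerSum, sub_mul]
    exact ((summable_norm_mul_pow ha hζ).of_norm.tsum_sub
      (summable_norm_mul_pow hb hζ).of_norm).symm
  rw [this]
  exact norm_powerSum_le h hζ

lemma continuousOn_powerSum {a : ℕ → ℂ} (ha : Summable fun n => ‖a n‖) :
    ContinuousOn (powerSum a) (Metric.closedBall 0 1) :=
  continuousOn_tsum (fun n => by fun_prop) ha fun n ζ hζ =>
    norm_mul_pow_le (by simpa using hζ) n

lemma differentiableOn_powerSum {a : ℕ → ℂ} (ha : Summable fun n => ‖a n‖) :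
    DifferentiableOn ℂ (powerSum a) (Metric.ball 0 1) :=
  Complex.differentiableOn_tsum_of_summable_norm ha (fun n => by fun_prop) Metric.isOpen_ball
    fun n ζ hζ => norm_mul_pow_le (by simpa using (Metric.ball_subset_closedBall hζ)) n

lemma summable_norm_squareCoeff {a : ℕ → ℂ} (ha : Summable fun n => ‖a n‖) :
    Summable fun n => ‖squareCoeff a n‖ :=
  summable_norm_sum_mul_antidiagonal_of_summable_norm ha ha

lemma sum_antidiagonal_mul_pow (a b : ℕ → ℂ) (ζ : ℂ) (n : ℕ) :
    ∑ kl ∈ Finset.HasAntidiagonal.antidiagonal n, (a kl.1 * ζ ^ kl.1) * (b kl.2 * ζ ^ kl.2) =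
      (∑ kl ∈ Finset.HasAntidiagonal.antidiagonal n, a kl.1 * b kl.2) * ζ ^ n := by
  rw [Finset.sum_mul]
  refine Finset.sum_congr rfl fun kl hkl => ?_
  rw [← Finset.HasAntidiagonal.mem_antidiagonal.1 hkl, pow_add]
  ring

lemma powerSum_squareCoeff {a : ℕ → ℂ} (ha : Summable fun n => ‖a n‖) {ζ : ℂ} (hζ : ‖ζ‖ ≤ 1) :
    powerSum (squareCoeff a) ζ = powerSum a ζ ^ 2 := by
  have h := summable_norm_mul_pow ha hζ
  rw [sq, powerSum, powerSum, tsum_mul_tsum_eq_tsum_sum_antidiagonal_of_summable_norm h h]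
  simp only [sum_antidiagonal_mul_pow]
  rfl

/-- Symmetry of the convolution turns the Euler operator applied to a square into a product. -/
lemma natCast_mul_squareCoeff (a : ℕ → ℂ) (n : ℕ) :
    (n : ℂ) * squareCoeff a n =
      2 * ∑ kl ∈ Finset.HasAntidiagonal.antidiagonal n, (kl.1 * a kl.1) * a kl.2 := by
  have h1 : (n : ℂ) * squareCoeff a n =
      (∑ kl ∈ Finset.HasAntidiagonal.antidiagonal n, (kl.1 * a kl.1) * a kl.2) +
      ∑ kl ∈ Finset.HasAntidiagonal.antidiagonal n, (kl.2 * a kl.2) * a kl.1 := by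
    rw [squareCoeff, Finset.mul_sum, ← Finset.sum_add_distrib]
    refine Finset.sum_congr rfl fun kl hkl => ?_
    rw [← Finset.HasAntidiagonal.mem_antidiagonal.1 hkl]
    push_cast
    ring
  have h2 : ∑ kl ∈ Finset.HasAntidiagonal.antidiagonal n, (kl.2 * a kl.2) * a kl.1 =
      ∑ kl ∈ Finset.HasAntidiagonal.antidiagonal n, (kl.1 * a kl.1) * a kl.2 :=
    Finset.Nat.sum_antidiagonal_swap (n := n) (f := fun kl => ((kl.1 : ℂ) * a kl.1) * a kl.2)
  rw [h1, h2, two_mul]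

/-- The Euler operator `ζ ∂_ζ` is a derivation: `ζ ∂_ζ (F²) = 2 F · ζ ∂_ζ F`. -/
lemma hasSum_euler_square {a : ℕ → ℂ} (ha : Summable fun n => ‖a n‖)
    (ha' : Summable fun n : ℕ => ‖(n : ℂ) * a n‖) {ζ : ℂ} (hζ : ‖ζ‖ ≤ 1) :
    HasSum (fun n : ℕ => (n : ℂ) * squareCoeff a n * ζ ^ n)
      (2 * (powerSum (fun n : ℕ => (n : ℂ) * a n) ζ * powerSum a ζ)) := by
  have h := summable_norm_mul_pow ha hζ
  have h' := summable_norm_mul_pow ha' hζ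
  have hs := (summable_norm_sum_mul_antidiagonal_of_summable_norm h' h).of_norm.hasSum
  rw [← tsum_mul_tsum_eq_tsum_sum_antidiagonal_of_summable_norm h' h] at hs
  refine (hs.mul_left 2).congr_fun fun n => ?_
  rw [sum_antidiagonal_mul_pow (fun n : ℕ => (n : ℂ) * a n) a, natCast_mul_squareCoeff]
  ring

lemma norm_squareCoeff_le {a : ℕ → ℂ} (ha : Summable fun n => ‖a n‖) {M : ℝ}
    (hM : ∑' n, ‖a n‖ ≤ M) (n : ℕ) : ‖squareCoeff a n‖ ≤ M ^ 2 := by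
  have hs : Summable fun n => ‖a n‖ := ha
  have hprod : Summable fun n : ℕ =>
      ∑ kl ∈ Finset.HasAntidiagonal.antidiagonal n, ‖a kl.1‖ * ‖a kl.2‖ := by
    have := summable_norm_sum_mul_antidiagonal_of_summable_norm hs.norm hs.norm
    exact this.of_norm
  calc ‖squareCoeff a n‖ ≤ ∑ kl ∈ Finset.HasAntidiagonal.antidiagonal n, ‖a kl.1‖ * ‖a kl.2‖ :=
        (norm_sum_le _ _).trans_eq (by simp only [norm_mul])
    _ ≤ ∑' n : ℕ, ∑ kl ∈ Finset.HasAntidiagonal.antidiagonal n, ‖a kl.1‖ * ‖a kl.2‖ :=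
        hprod.le_tsum n fun _ _ => Finset.sum_nonneg fun _ _ => by positivity
    _ = (∑' n, ‖a n‖) ^ 2 := by
        rw [sq, tsum_mul_tsum_eq_tsum_sum_antidiagonal_of_summable_norm hs.norm hs.norm]
    _ ≤ M ^ 2 := pow_le_pow_left₀ (tsum_nonneg fun _ => norm_nonneg _) hM 2

/-! ### Characteristics of the complex Burgers equation -/

/-- A solution of `‖g'‖ ≤ K ‖g‖` on the open interval `(0, τ)` that tends to `0` at `0` vanishes. -/
lemma eq_zero_of_norm_deriv_le_of_tendsto {g g' : ℝ → ℂ} {K τ : ℝ}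
    (hg : ∀ t ∈ Ioo 0 τ, HasDerivAt g (g' t) t) (hb : ∀ t ∈ Ioo 0 τ, ‖g' t‖ ≤ K * ‖g t‖)
    (h0 : Tendsto g (𝓝[>] 0) (𝓝 0)) : ∀ t ∈ Ioo 0 τ, g t = 0 := by
  intro t ht
  have hev : ∀ᶠ ε in 𝓝[>] (0 : ℝ), ‖g t‖ ≤ ‖g ε‖ * rexp (K * (t - ε)) := by
    filter_upwards [Ioo_mem_nhdsGT ht.1] with ε hε
    have hsub : ∀ x ∈ Icc ε t, x ∈ Ioo 0 τ := fun x hx =>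
      ⟨hε.1.trans_le hx.1, hx.2.trans_lt ht.2⟩
    have := norm_le_gronwallBound_of_norm_deriv_right_le (f := g) (f' := g') (δ := ‖g ε‖) (K := K)
      (ε := 0) (a := ε) (b := t) (fun x hx => (hg x (hsub x hx)).continuousAt.continuousWithinAt)
      (fun x hx => (hg x (hsub x (Ico_subset_Icc_self hx))).hasDerivWithinAt) le_rfl
      (fun x hx => by simpa using hb x (hsub x (Ico_subset_Icc_self hx))) t ⟨hε.2.le, le_rfl⟩
    simpa [gronwallBound_ε0] using this
  have hlim : Tendsto (fun ε => ‖g ε‖ * rexp (K * (t - ε))) (𝓝[>] 0) (𝓝 (‖(0 : ℂ)‖ *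
      rexp (K * (t - 0)))) := by
    refine h0.norm.mul ?_
    exact ((by fun_prop : Continuous fun ε : ℝ => rexp (K * (t - ε))).tendsto 0).mono_left
      nhdsWithin_le_nhds
  have := ge_of_tendsto hlim hev
  simpa using this

/-- Data of a power series `∑ aₙ(t) ζⁿ` that solves `∂ₜ F = ¼ ζ ∂_ζ (F²)` coefficient by coefficient
on `(0, τ)`, with `∑ (1 + n) |aₙ(t)|` bounded and with the initial value attained in `ℓ¹`. -/
structure IsDiscSolution (τ M : ℝ) (a : ℝ → ℕ → ℂ) : Prop where
  summable : ∀ t ∈ Ico 0 τ, Summable fun n => ‖a t n‖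
  summable_euler : ∀ t ∈ Ico 0 τ, Summable fun n : ℕ => ‖(n : ℂ) * a t n‖
  tsum_le : ∀ t ∈ Ico 0 τ, ∑' n, ‖a t n‖ ≤ M
  tsum_euler_le : ∀ t ∈ Ico 0 τ, ∑' n : ℕ, ‖(n : ℂ) * a t n‖ ≤ M
  hasDerivAt : ∀ t ∈ Ioo 0 τ, ∀ n : ℕ,
    HasDerivAt (fun r => a r n) ((n : ℂ) / 4 * squareCoeff (a t) n) t
  tendsto : Tendsto (fun t => ∑' n, ‖a t n - a 0 n‖) (𝓝[>] 0) (𝓝 0)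

/-- The characteristic of `∂ₜ F = ½ F ζ ∂_ζ F` that starts at `ζ` with the value `z`. -/
noncomputable def characteristic (z ζ : ℂ) (t : ℝ) : ℂ := ζ * Complex.exp (-(t / 2) * z)

lemma norm_characteristic (z ζ : ℂ) (t : ℝ) :
    ‖characteristic z ζ t‖ = ‖ζ‖ * rexp (-(t / 2) * z.re) := by
  rw [characteristic, norm_mul, Complex.norm_exp]
  congr 2
  have : (-((t : ℂ) / 2) * z) = ((-(t / 2) : ℝ) : ℂ) * z := by push_cast; ring
  rw [this, Complex.re_ofReal_mul]

lemma hasDerivAt_characteristic (z ζ : ℂ) (t : ℝ) :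
    HasDerivAt (characteristic z ζ) (-(z / 2) * characteristic z ζ t) t := by
  have h1 : HasDerivAt (fun t : ℝ => -((t : ℂ) / 2) * z) (-(1 / 2) * z) t :=
    ((((hasDerivAt_id (t : ℂ)).comp_ofReal).div_const 2).neg.mul_const z)
  refine (h1.cexp.const_mul ζ).congr_deriv ?_
  simp only [characteristic]
  ring

/-- `F` is constant along a characteristic that enters the open disc. -/
lemma IsDiscSolution.powerSum_characteristic {τ M : ℝ} {a : ℝ → ℕ → ℂ}
    (h : IsDiscSolution τ M a) {ζ : ℂ} (hζ : ‖ζ‖ = 1) (hpos : 0 < (powerSum (a 0) ζ).re) :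
    ∀ t ∈ Ioo 0 τ, powerSum (a t) (characteristic (powerSum (a 0) ζ) ζ t) = powerSum (a 0) ζ := by
  intro t₀ ht₀
  set z := powerSum (a 0) ζ with hz
  set p := characteristic z ζ with hp
  have h0 : (0 : ℝ) ∈ Ico 0 τ := ⟨le_rfl, ht₀.1.trans ht₀.2⟩
  have hnorm : ∀ t : ℝ, ‖p t‖ = rexp (-(t / 2) * z.re) := fun t => by
    rw [hp, norm_characteristic, hζ, one_mul]
  have hle : ∀ t : ℝ, 0 ≤ t → ‖p t‖ ≤ 1 := fun t ht => by
    rw [hnorm, Real.exp_le_one_iff]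
    nlinarith
  have hmono : ∀ s t : ℝ, s ≤ t → ‖p t‖ ≤ ‖p s‖ := fun s t hst => by
    rw [hnorm, hnorm, Real.exp_le_exp]
    nlinarith
  have hp' : ∀ t, HasDerivAt p (-(z / 2) * p t) t := hasDerivAt_characteristic z ζ
  have hD : ∀ t ∈ Ioo 0 τ, HasDerivAt (fun r => powerSum (a r) (p r))
      (1 / 2 * powerSum (fun n : ℕ => (n : ℂ) * a t n) (p t) * (powerSum (a t) (p t) - z)) t := by
    intro t ht
    have hM : 0 ≤ M := (tsum_nonneg fun _ => norm_nonneg _).trans (h.tsum_le 0 h0)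
    -- On `(t / 2, τ)` the characteristic stays in the disc of radius `ρ < 1`, which gives a
    -- geometric bound for the differentiated series.
    set ρ := ‖p (t / 2)‖ with hρ
    have hρ1 : ρ < 1 := by
      rw [hρ, hnorm, Real.exp_lt_one_iff]
      nlinarith [ht.1]
    have hsumu : Summable fun n : ℕ => ((M ^ 2 / 4 + ‖z‖ / 2 * M) * (n : ℝ) ^ 1) * ρ ^ n := by
      have := summable_pow_mul_geometric_of_norm_lt_one (R := ℝ) 1 (r := ρ)
        (by rw [norm_norm]; exact hρ1)
      simpa only [mul_assoc] using this.mul_left (M ^ 2 / 4 + ‖z‖ / 2 * M)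
    have hsub : Ioo (t / 2) τ ⊆ Ioo 0 τ := Ioo_subset_Ioo_left (by linarith [ht.1])
    have hterm : ∀ (n : ℕ), ∀ r ∈ Ioo (t / 2) τ, HasDerivAt (fun r => a r n * p r ^ n)
        (((n : ℂ) / 4 * squareCoeff (a r) n - z / 2 * (n * a r n)) * p r ^ n) r := by
      intro n r hr
      refine ((h.hasDerivAt r (hsub hr) n).mul ((hp' r).pow n)).congr_deriv ?_
      simp only [Pi.pow_apply]
      rcases n with _ | n
      · simp
      · simp only [Nat.add_sub_cancel, pow_succ]
        push_cast
        ring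
    have hbound : ∀ (n : ℕ), ∀ r ∈ Ioo (t / 2) τ,
        ‖((n : ℂ) / 4 * squareCoeff (a r) n - z / 2 * (n * a r n)) * p r ^ n‖ ≤
          ((M ^ 2 / 4 + ‖z‖ / 2 * M) * (n : ℝ) ^ 1) * ρ ^ n := by
      intro n r hr
      have hr' : r ∈ Ico 0 τ := Ioo_subset_Ico_self (hsub hr)
      rw [norm_mul, norm_pow]
      refine mul_le_mul ?_ (pow_le_pow_left₀ (norm_nonneg _) (hmono _ _ hr.1.le) n)
        (by positivity) (by positivity)
      have h1 : ‖squareCoeff (a r) n‖ ≤ M ^ 2 :=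
        norm_squareCoeff_le (h.summable r hr') (h.tsum_le r hr') n
      have h2 : ‖a r n‖ ≤ M :=
        ((h.summable r hr').le_tsum n fun _ _ => norm_nonneg _).trans (h.tsum_le r hr')
      calc ‖(n : ℂ) / 4 * squareCoeff (a r) n - z / 2 * (n * a r n)‖
          ≤ ‖(n : ℂ) / 4 * squareCoeff (a r) n‖ + ‖z / 2 * (n * a r n)‖ := norm_sub_le _ _
        _ = (n : ℝ) / 4 * ‖squareCoeff (a r) n‖ + ‖z‖ / 2 * (n * ‖a r n‖) := by simp
        _ ≤ (n : ℝ) / 4 * M ^ 2 + ‖z‖ / 2 * (n * M) := by gcongr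
        _ = _ := by ring
    have htm : t ∈ Ioo (t / 2) τ := ⟨by linarith [ht.1], ht.2⟩
    have hpt := hle t ht.1.le
    have hsum := hasDerivAt_tsum_of_isPreconnected hsumu isOpen_Ioo isPreconnected_Ioo hterm hbound
      htm (summable_norm_mul_pow (h.summable t (Ioo_subset_Ico_self ht)) hpt).of_norm htm
    refine hsum.congr_deriv ?_
    have hs1 := hasSum_euler_square (h.summable t (Ioo_subset_Ico_self ht))
      (h.summable_euler t (Ioo_subset_Ico_self ht)) hpt
    have hs2 := (summable_norm_mul_pow (h.summable_euler t (Ioo_subset_Ico_self ht)) hpt).of_norm.hasSum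
    have hs := (hs1.mul_left (1 / 4)).sub (hs2.mul_left (z / 2))
    refine ((tsum_congr fun n => by ring).trans hs.tsum_eq).trans ?_
    simp only [powerSum]
    ring
  have hlim : Tendsto (fun r => powerSum (a r) (p r) - z) (𝓝[>] 0) (𝓝 0) := by
    have hp0 : p 0 = ζ := by simp [hp, characteristic]
    have hc : ContinuousWithinAt (fun r => powerSum (a 0) (p r)) (Ici 0) 0 := by
      refine ContinuousWithinAt.comp (t := Metric.closedBall 0 1)
        (continuousOn_powerSum (h.summable 0 h0) _ ?_)
        (hp' 0).continuousAt.continuousWithinAt ?_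
      · simpa using hle 0 le_rfl
      · intro r hr
        simpa using hle r hr
    have hc' : Tendsto (fun r => powerSum (a 0) (p r)) (𝓝[>] 0) (𝓝 z) := by
      have := hc.tendsto.mono_left (nhdsWithin_mono 0 Ioi_subset_Ici_self)
      simpa only [hp0] using this
    have hd : Tendsto (fun r => powerSum (a r) (p r) - powerSum (a 0) (p r)) (𝓝[>] 0) (𝓝 0) := by
      refine squeeze_zero_norm' ?_ h.tendsto
      filter_upwards [Ioo_mem_nhdsGT h0.2] with r hr
      exact norm_powerSum_sub_le (h.summable r (Ioo_subset_Ico_self hr)) (h.summable 0 h0)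
        (hle r hr.1.le)
    have := hd.add (hc'.sub_const z)
    simpa using this
  -- The deviation `F - z` solves the linear equation `g' = ½ (ζ ∂_ζ F) g` with bounded coefficient.
  have hzero := eq_zero_of_norm_deriv_le_of_tendsto (g := fun r => powerSum (a r) (p r) - z)
    (K := M / 2) (fun t ht => (hD t ht).sub_const z) (fun t ht => ?_) hlim t₀ ht₀
  · exact sub_eq_zero.1 hzero
  · rw [norm_mul]
    refine mul_le_mul_of_nonneg_right ?_ (norm_nonneg _)
    have := (norm_powerSum_le (h.summable_euler t (Ioo_subset_Ico_self ht)) (hle t ht.1.le)).trans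
      (h.tsum_euler_le t (Ioo_subset_Ico_self ht))
    rw [norm_mul]
    norm_num
    linarith

/-! ### Analyticity of the initial value where the characteristics enter the disc -/

lemma norm_exp_mul_I (x : ℝ) : ‖Complex.exp (x * Complex.I)‖ = 1 :=
  Complex.norm_exp_ofReal_mul_I x

lemma hasDerivAt_cexp_ofReal_mul_I (x : ℝ) :
    HasDerivAt (fun x : ℝ => Complex.exp (x * Complex.I))
      (Complex.I * Complex.exp (x * Complex.I)) x := by
  refine ((((hasDerivAt_id (x : ℂ)).comp_ofReal).mul_const Complex.I).cexp).congr_deriv ?_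
  simp [mul_comm]

/-- On the unit circle a power series with `∑ n |aₙ| < ∞` is differentiable in the angle. -/
lemma differentiable_powerSum_circle {a : ℕ → ℂ} (ha : Summable fun n => ‖a n‖)
    (ha' : Summable fun n : ℕ => ‖(n : ℂ) * a n‖) :
    Differentiable ℝ fun x : ℝ => powerSum a (Complex.exp (x * Complex.I)) := by
  intro x
  have hterm : ∀ (n : ℕ) (y : ℝ), HasDerivAt (fun y : ℝ => a n * Complex.exp (y * Complex.I) ^ n)
      (Complex.I * (n * a n) * Complex.exp (y * Complex.I) ^ n) y := by
    intro n y
    refine (((hasDerivAt_cexp_ofReal_mul_I y).pow n).const_mul (a n)).congr_deriv ?_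
    rcases n with _ | n
    · simp
    · simp only [Nat.add_sub_cancel, pow_succ]
      push_cast
      ring
  refine (hasDerivAt_tsum ha' hterm (fun n y => ?_) (y₀ := x) ?_ x).differentiableAt
  · refine (norm_mul_pow_le (norm_exp_mul_I y).le n).trans ?_
    simp
  · exact (summable_norm_mul_pow ha (norm_exp_mul_I x).le).of_norm

/-- If `F` is constant along the characteristics that enter the disc, then the initial value is
real-analytic at the points of the circle where its real part is positive. The map
`p ↦ p exp (t F(t, p) / 2)` runs the characteristics backwards; it is holomorphic in the disc, and
it is locally invertible because the characteristics through the circle are differentiable in the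
angle. Hence the time-`t` position depends analytically on the angle, and so does the value that it
carries. -/
lemma IsDiscSolution.analyticAt {τ M : ℝ} {a : ℝ → ℕ → ℂ} (h : IsDiscSolution τ M a) (hτ : 0 < τ)
    {x₀ : ℝ} (hpos : 0 < (powerSum (a 0) (Complex.exp (x₀ * Complex.I))).re) :
    AnalyticAt ℝ (fun x : ℝ => powerSum (a 0) (Complex.exp (x * Complex.I))) x₀ := by
  set e : ℝ → ℂ := fun x => Complex.exp (x * Complex.I) with he
  set Z : ℝ → ℂ := fun x => powerSum (a 0) (e x) with hZ
  have h0 : (0 : ℝ) ∈ Ico 0 τ := ⟨le_rfl, hτ⟩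
  set t := τ / 2 with ht
  have htm : t ∈ Ioo 0 τ := ⟨by linarith, by linarith⟩
  set G : ℂ → ℂ := powerSum (a t) with hG
  set Φ : ℝ → ℂ := fun x => characteristic (Z x) (e x) t with hΦ
  set Ψ : ℂ → ℂ := fun p => p * Complex.exp (t / 2 * G p) with hΨ
  have hZd : Differentiable ℝ Z := differentiable_powerSum_circle (h.summable 0 h0)
    (h.summable_euler 0 h0)
  have hed : ∀ x, HasDerivAt e (Complex.I * e x) x := hasDerivAt_cexp_ofReal_mul_I
  have hΦd : Differentiable ℝ Φ := by
    have hed' : Differentiable ℝ e := fun x => (hed x).differentiableAt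
    simp only [hΦ, characteristic]
    fun_prop
  have hev : ∀ᶠ x in 𝓝 x₀, 0 < (Z x).re :=
    ((Complex.continuous_re.comp hZd.continuous).continuousAt).eventually_const_lt hpos
  have hconst : ∀ᶠ x in 𝓝 x₀, G (Φ x) = Z x := by
    filter_upwards [hev] with x hx
    exact h.powerSum_characteristic (norm_exp_mul_I x) hx t htm
  have hback : ∀ᶠ x in 𝓝 x₀, Ψ (Φ x) = e x := by
    filter_upwards [hconst] with x hx
    simp only [hΨ, hx]
    simp only [hΦ, characteristic, mul_assoc]
    rw [← Complex.exp_add]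
    simp
  have hp₀ : Φ x₀ ∈ Metric.ball (0 : ℂ) 1 := by
    rw [mem_ball_zero_iff, hΦ, norm_characteristic, norm_exp_mul_I, one_mul, Real.exp_lt_one_iff]
    have := htm.1
    nlinarith
  have hGa : AnalyticAt ℂ G (Φ x₀) :=
    (differentiableOn_powerSum (h.summable t (Ioo_subset_Ico_self htm))).analyticAt
      (Metric.isOpen_ball.mem_nhds hp₀)
  have hΨa : AnalyticAt ℂ Ψ (Φ x₀) :=
    analyticAt_id.mul ((analyticAt_const.mul hGa).cexp)
  have hΨd : HasDerivAt Ψ (deriv Ψ (Φ x₀)) (Φ x₀) := hΨa.differentiableAt.hasDerivAt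
  -- The chain rule for `Ψ ∘ Φ = e` shows that `Ψ'` does not vanish.
  have hne : deriv Ψ (Φ x₀) ≠ 0 := by
    have h1 : HasDerivAt (fun x => Ψ (Φ x)) (deriv Ψ (Φ x₀) * deriv Φ x₀) x₀ :=
      hΨd.comp x₀ (hΦd x₀).hasDerivAt
    have h2 : HasDerivAt (fun x => Ψ (Φ x)) (Complex.I * e x₀) x₀ :=
      (hed x₀).congr_of_eventuallyEq hback
    intro hzero
    have h3 := h1.unique h2
    rw [hzero, zero_mul] at h3
    exact mul_ne_zero Complex.I_ne_zero (Complex.exp_ne_zero _) h3.symm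
  have hΨs : HasStrictDerivAt Ψ (deriv Ψ (Φ x₀)) (Φ x₀) :=
    hΨa.hasStrictDerivAt
  set L := hΨs.localInverse Ψ _ _ hne with hL
  have hLleft : ∀ᶠ p in 𝓝 (Φ x₀), L (Ψ p) = p :=
    (hΨs.hasStrictFDerivAt_equiv hne).eventually_left_inverse
  have hLa : AnalyticAt ℂ L (e x₀) := by
    have hΨc : ContDiffAt ℂ ω Ψ (Φ x₀) := hΨa.contDiffAt
    have := hΨc.to_localInverse (hΨs.hasStrictFDerivAt_equiv hne).hasFDerivAt (by simp)
    rw [hback.self_of_nhds] at this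
    exact this.analyticAt
  have hLe : L (e x₀) = Φ x₀ := by
    rw [← hback.self_of_nhds]
    exact hLleft.self_of_nhds
  have hfinal : ∀ᶠ x in 𝓝 x₀, G (L (e x)) = Z x := by
    filter_upwards [hconst, hback, hΦd.continuous.continuousAt.eventually hLleft] with x h1 h2 h3
    rw [← h2, h3, h1]
  refine AnalyticAt.congr ?_ hfinal
  have hea : AnalyticAt ℝ e x₀ := by
    have h1 : AnalyticAt ℝ (fun x : ℝ => (x : ℂ) * Complex.I) x₀ :=
      (Complex.ofRealCLM.analyticAt x₀).mul analyticAt_const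
    exact (analyticAt_cexp (z := (x₀ : ℂ) * Complex.I)).restrictScalars.comp_of_eq h1 rfl
  have hGL : AnalyticAt ℂ (fun p => G (L p)) (e x₀) := by
    exact hGa.comp_of_eq hLa hLe
  exact hGL.restrictScalars.comp hea

/-! ### The periodic Hilbert transform of a power series -/

/-- The kernel `cot(u/2) / 2` of the periodic Hilbert transform. -/
noncomputable def halfCot (u : ℝ) : ℝ := cos (u / 2) / (2 * sin (u / 2))

/-- This holds at every point: where `tan` or the quotient takes a junk value, both sides vanish. -/
lemma div_two_mul_tan (c x : ℝ) : c / (2 * tan (x / 2)) = c * halfCot x := by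
  rw [halfCot, tan_eq_sin_div_cos, ← mul_div_assoc, div_div_eq_mul_div, mul_div_assoc]

lemma halfCot_neg (u : ℝ) : halfCot (-u) = -halfCot u := by
  simp [halfCot, neg_div, div_neg]

lemma sin_half_pos {u : ℝ} (hu : u ∈ Ioc 0 π) : 0 < sin (u / 2) :=
  sin_pos_of_pos_of_lt_pi (by linarith [hu.1]) (by linarith [hu.2, pi_pos])

lemma continuousOn_halfCot : ContinuousOn halfCot (Ioc 0 π) := by
  unfold halfCot
  refine ContinuousOn.div (by fun_prop) (by fun_prop) fun u hu => ?_
  have := sin_half_pos hu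
  positivity

lemma abs_sin_natCast_mul_le (n : ℕ) (x : ℝ) : |sin (n * x)| ≤ n * |sin x| := by
  induction n with
  | zero => simp
  | succ n ih =>
    rw [Nat.cast_succ, add_mul, one_mul, sin_add, add_mul, one_mul]
    refine (abs_add_le _ _).trans ?_
    rw [abs_mul, abs_mul]
    have h1 := abs_cos_le_one x
    have h2 := abs_cos_le_one (n * x)
    have h3 := abs_nonneg (sin x)
    have h4 := abs_nonneg (sin (n * x))
    nlinarith

/-- `|sin (n u)| ≤ 2 n |sin (u / 2)|` compensates the singularity of the kernel. -/
lemma abs_sin_mul_halfCot_le (n : ℕ) (u : ℝ) : |sin (n * u) * halfCot u| ≤ n := by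
  have h1 : |sin (n * u)| ≤ 2 * n * |sin (u / 2)| := by
    have := abs_sin_natCast_mul_le (2 * n) (u / 2)
    have hu : ((2 * n : ℕ) : ℝ) * (u / 2) = n * u := by push_cast; ring
    rw [hu] at this
    exact_mod_cast this
  rw [halfCot, abs_mul, abs_div, abs_mul, abs_two]
  rcases eq_or_ne (sin (u / 2)) 0 with h0 | h0
  · simp [h0]
  · have h2 := abs_cos_le_one (u / 2)
    have h3 : 0 < |sin (u / 2)| := abs_pos.2 h0
    rw [← mul_div_assoc, div_le_iff₀ (by positivity)]
    calc |sin (n * u)| * |cos (u / 2)| ≤ |sin (n * u)| * 1 := by gcongr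
      _ ≤ n * (2 * |sin (u / 2)|) := by linarith

lemma intervalIntegrable_sin_mul_halfCot (n : ℕ) :
    IntervalIntegrable (fun u => sin (n * u) * halfCot u) volume 0 π := by
  rw [intervalIntegrable_iff_integrableOn_Ioc_of_le pi_pos.le]
  refine Measure.integrableOn_of_bounded (M := n) (by simp) ?_ ?_
  · have : Measurable fun u => sin (n * u) * halfCot u := by
      unfold halfCot
      fun_prop
    exact this.aestronglyMeasurable
  · exact ae_of_all _ fun u => abs_sin_mul_halfCot_le n u

lemma integral_cos_natCast_mul (n : ℕ) :
    ∫ u in (0 : ℝ)..π, cos (n * u) = if n = 0 then π else 0 := by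
  rcases eq_or_ne n 0 with rfl | hn
  · simp
  · have : (n : ℝ) ≠ 0 := by exact_mod_cast hn
    rw [intervalIntegral.integral_comp_mul_left _ this]
    simp [hn, sin_nat_mul_pi]

/-- The conjugate Dirichlet integral `∫₀^π sin (n u) cot (u / 2) / 2 du = π / 2`, `n ≥ 1`. -/
lemma integral_sin_mul_halfCot (n : ℕ) :
    ∫ u in (0 : ℝ)..π, sin ((n + 1 : ℕ) * u) * halfCot u = π / 2 := by
  have hstep : ∀ m : ℕ, (∫ u in (0 : ℝ)..π, sin ((m + 1 : ℕ) * u) * halfCot u) =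
      (∫ u in (0 : ℝ)..π, sin (m * u) * halfCot u) +
        ((∫ u in (0 : ℝ)..π, cos ((m + 1 : ℕ) * u)) + ∫ u in (0 : ℝ)..π, cos (m * u)) / 2 := by
    intro m
    rw [← intervalIntegral.integral_add (Continuous.intervalIntegrable (by fun_prop) _ _)
        (Continuous.intervalIntegrable (by fun_prop) _ _), ← intervalIntegral.integral_div,
      ← intervalIntegral.integral_add (intervalIntegrable_sin_mul_halfCot m)
        (Continuous.intervalIntegrable (by fun_prop) _ _)]
    refine intervalIntegral.integral_congr_ae (ae_of_all _ fun u hu => ?_)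
    rw [uIoc_of_le pi_pos.le] at hu
    have hs := (sin_half_pos hu).ne'
    -- Consecutive integrands differ by `(cos ((m + 1) u) + cos (m u)) / 2`.
    have hkey : ∀ A B : ℝ, sin B ≠ 0 → sin (A + B) * (cos B / (2 * sin B)) =
        sin (A - B) * (cos B / (2 * sin B)) + (cos (A + B) + cos (A - B)) / 2 := by
      intro A B hB
      field_simp
      rw [sin_add, sin_sub, cos_add, cos_sub]
      ring
    have h := hkey (m * u + u / 2) (u / 2) hs
    have e1 : (m * u + u / 2) + u / 2 = ((m + 1 : ℕ) : ℝ) * u := by push_cast; ring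
    rw [e1, add_sub_cancel_right] at h
    exact h
  induction n with
  | zero =>
    rw [hstep, integral_cos_natCast_mul, integral_cos_natCast_mul]
    simp
  | succ n ih =>
    rw [hstep, ih, integral_cos_natCast_mul, integral_cos_natCast_mul]
    simp

/-- Folding the principal value about its centre. -/
lemma setIntegral_hilbertKernel {f : ℝ → ℝ} (hf : Continuous f) (α : ℝ) {ε : ℝ} (hε : ε ∈ Ioo 0 π) :
    ∫ β in {β : ℝ | ε < |α - β| ∧ |α - β| ≤ π}, f β / (2 * tan ((α - β) / 2)) =
      ∫ u in ε..π, (f (α - u) - f (α + u)) * halfCot u := by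
  have hset : {β : ℝ | ε < |α - β| ∧ |α - β| ≤ π} =
      Ico (α - π) (α - ε) ∪ Ioc (α + ε) (α + π) := by
    ext β
    simp only [mem_ofPred_eq, lt_abs, abs_le, mem_union, mem_Ico, mem_Ioc]
    have := hε.1
    have := hε.2
    constructor
    · rintro ⟨h1 | h1, h2, h3⟩
      · left; constructor <;> linarith
      · right; constructor <;> linarith
    · rintro (⟨h1, h2⟩ | ⟨h1, h2⟩)
      · refine ⟨Or.inl (by linarith), by linarith, by linarith⟩
      · refine ⟨Or.inr (by linarith), by linarith, by linarith⟩
  have hk : ContinuousOn halfCot (Icc ε π) :=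
    continuousOn_halfCot.mono fun u hu => ⟨hε.1.trans_le hu.1, hu.2⟩
  simp only [div_two_mul_tan]
  have hc1 : ContinuousOn (fun β => f β * halfCot (α - β)) (Icc (α - π) (α - ε)) := by
    refine hf.continuousOn.mul (hk.comp (by fun_prop) fun β hβ => ?_)
    constructor <;> linarith [hβ.1, hβ.2]
  have hc2 : ContinuousOn (fun β => f β * halfCot (α - β)) (Icc (α + ε) (α + π)) := by
    have : ContinuousOn (fun β => f β * -halfCot (β - α)) (Icc (α + ε) (α + π)) := by
      refine hf.continuousOn.mul (hk.comp (by fun_prop) fun β hβ => ?_).neg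
      constructor <;> linarith [hβ.1, hβ.2]
    refine this.congr fun β _ => ?_
    simp only [← halfCot_neg, neg_sub]
  have hdisj : Disjoint (Ico (α - π) (α - ε)) (Ioc (α + ε) (α + π)) := by
    rw [Set.disjoint_left]
    intro β h1 h2
    linarith [h1.2, h2.1, hε.1]
  have hi1 : ContinuousOn (fun u => f (α - u) * halfCot u) (uIcc ε π) := by
    rw [uIcc_of_le hε.2.le]
    exact (Continuous.continuousOn (by fun_prop)).mul hk
  have hi2 : ContinuousOn (fun u => f (α + u) * halfCot u) (uIcc ε π) := by
    rw [uIcc_of_le hε.2.le]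
    exact (Continuous.continuousOn (by fun_prop)).mul hk
  rw [hset, setIntegral_union hdisj measurableSet_Ioc
      (hc1.integrableOn_Icc.mono_set Ico_subset_Icc_self)
      (hc2.integrableOn_Icc.mono_set Ioc_subset_Icc_self), integral_Ico_eq_integral_Ioc,
    ← intervalIntegral.integral_of_le (by linarith [hε.2]),
    ← intervalIntegral.integral_of_le (by linarith [hε.2])]
  simp only [sub_mul]
  rw [intervalIntegral.integral_sub hi1.intervalIntegrable hi2.intervalIntegrable,
    sub_eq_add_neg (∫ u in ε..π, f (α - u) * halfCot u)]
  congr 1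
  · rw [← intervalIntegral.integral_comp_sub_left (fun β => f β * halfCot (α - β)) α]
    simp
  · rw [← intervalIntegral.integral_comp_add_left (fun β => f β * halfCot (α - β)) α,
      ← intervalIntegral.integral_neg]
    simp [halfCot_neg]

/-- If the folded integrand is integrable up to the singularity, the principal value is its
integral. -/
lemma periodicHilbert_eq_integral {f : ℝ → ℝ} (hf : Continuous f) (α : ℝ)
    (hint : IntervalIntegrable (fun u => (f (α - u) - f (α + u)) * halfCot u) volume 0 π) :
    periodicHilbert f α = 1 / π * ∫ u in (0 : ℝ)..π, (f (α - u) - f (α + u)) * halfCot u := by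
  refine Tendsto.limUnder_eq ?_
  refine Tendsto.const_mul _ ?_
  have hc := intervalIntegral.continuousOn_primitive_interval' hint.symm left_mem_uIcc
  have hlim := (hc 0 right_mem_uIcc).neg.tendsto.mono_left (nhdsWithin_mono 0
    (show Ioc 0 π ⊆ uIcc π 0 by rw [uIcc_of_ge pi_pos.le]; exact Ioc_subset_Icc_self))
  rw [nhdsWithin_Ioc_eq_nhdsGT pi_pos] at hlim
  simp only [Pi.neg_apply, ← intervalIntegral.integral_symm] at hlim
  refine hlim.congr' ?_
  filter_upwards [Ioo_mem_nhdsGT pi_pos] with ε hε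
  rw [setIntegral_hilbertKernel hf α hε, intervalIntegral.integral_symm π ε]
  rfl

/-- The Hilbert transform of the real part of a power series without constant term is its imaginary
part. -/
lemma periodicHilbert_re_powerSum {a : ℕ → ℂ} (h0 : a 0 = 0) (ha : Summable fun n => ‖a n‖)
    (ha' : Summable fun n : ℕ => ‖(n : ℂ) * a n‖) (α : ℝ) :
    periodicHilbert (fun x => (powerSum a (Complex.exp (x * Complex.I))).re) α =
      (powerSum a (Complex.exp (α * Complex.I))).im := by
  set Z : ℝ → ℂ := fun x => powerSum a (Complex.exp (x * Complex.I)) with hZ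
  have hZc : Continuous Z := (differentiable_powerSum_circle ha ha').continuous
  set F : ℕ → ℝ → ℂ := fun n u => (a n * Complex.exp (α * Complex.I) ^ n * (-2 * Complex.I)) *
    ((sin (n * u) * halfCot u : ℝ) : ℂ) with hF
  set g : ℝ → ℂ := fun u => (Z (α - u) - Z (α + u)) * (halfCot u : ℂ) with hg
  have hsum : ∀ u, HasSum (fun n => F n u) (g u) := by
    intro u
    have h1 := (summable_norm_mul_pow ha (norm_exp_mul_I (α - u)).le).of_norm.hasSum
    have h2 := (summable_norm_mul_pow ha (norm_exp_mul_I (α + u)).le).of_norm.hasSum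
    refine ((h1.sub h2).mul_right (halfCot u : ℂ)).congr_fun fun n => ?_
    simp only [hF]
    rw [← Complex.exp_nat_mul, ← Complex.exp_nat_mul, ← Complex.exp_nat_mul]
    have e1 : (n : ℂ) * (((α - u : ℝ) : ℂ) * Complex.I) =
      n * (α * Complex.I) + (-(n * u : ℂ)) * Complex.I := by push_cast; ring
    have e2 : (n : ℂ) * (((α + u : ℝ) : ℂ) * Complex.I) =
      n * (α * Complex.I) + (n * u : ℂ) * Complex.I := by push_cast; ring
    rw [e1, e2, Complex.exp_add, Complex.exp_add, Complex.exp_mul_I, Complex.exp_mul_I]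
    push_cast
    rw [Complex.sin_neg, Complex.cos_neg]
    ring
  have hFb : ∀ n u, ‖F n u‖ ≤ 2 * ‖(n : ℂ) * a n‖ := by
    intro n u
    have h1 : ‖a n * Complex.exp (α * Complex.I) ^ n‖ ≤ ‖a n‖ :=
      norm_mul_pow_le (norm_exp_mul_I α).le n
    have h2 : ‖((sin (n * u) * halfCot u : ℝ) : ℂ)‖ ≤ n := by
      rw [Complex.norm_real]
      exact abs_sin_mul_halfCot_le n u
    calc ‖F n u‖ = ‖a n * Complex.exp (α * Complex.I) ^ n‖ * 2 *
          ‖((sin (n * u) * halfCot u : ℝ) : ℂ)‖ := by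
            simp only [hF]
            rw [norm_mul, norm_mul (a n * Complex.exp (α * Complex.I) ^ n)]
            norm_num
      _ ≤ ‖a n‖ * 2 * n := by gcongr
      _ = _ := by rw [norm_mul, Complex.norm_natCast]; ring
  have hhalf : Measurable halfCot := by
    unfold halfCot
    fun_prop
  have hgm : Measurable g := by
    have h1 : Measurable fun u => Z (α - u) - Z (α + u) := Continuous.measurable (by fun_prop)
    exact h1.mul (Complex.measurable_ofReal.comp hhalf)
  have hgb : ∀ u, ‖g u‖ ≤ ∑' n : ℕ, 2 * ‖(n : ℂ) * a n‖ := fun u => by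
    rw [← (hsum u).tsum_eq]
    exact tsum_of_norm_bounded (ha'.mul_left 2).hasSum fun n => hFb n u
  have hgi : IntervalIntegrable g volume 0 π := by
    rw [intervalIntegrable_iff_integrableOn_Ioc_of_le pi_pos.le]
    exact Measure.integrableOn_of_bounded (by simp) hgm.aestronglyMeasurable (ae_of_all _ hgb)
  have hFint : ∀ n, ∫ u in (0 : ℝ)..π, F n u =
      (-(π : ℂ) * Complex.I) * (a n * Complex.exp (α * Complex.I) ^ n) := by
    intro n
    simp only [hF]
    rw [intervalIntegral.integral_const_mul, intervalIntegral.integral_ofReal]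
    rcases n with _ | n
    · simp [h0]
    · rw [integral_sin_mul_halfCot]
      push_cast
      ring
  have hI : HasSum (fun n => ∫ u in (0 : ℝ)..π, F n u) (∫ u in (0 : ℝ)..π, g u) := by
    refine intervalIntegral.hasSum_integral_of_dominated_convergence
      (fun n _ => 2 * ‖(n : ℂ) * a n‖) (fun n => ?_) (fun n => ae_of_all _ fun u _ => hFb n u)
      (ae_of_all _ fun _ _ => ha'.mul_left 2) intervalIntegrable_const
      (ae_of_all _ fun u _ => hsum u)
    have : Measurable (F n) := by
      have h1 : Measurable fun u : ℝ => sin (n * u) * halfCot u := by fun_prop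
      exact (Complex.measurable_ofReal.comp h1).const_mul _
    exact this.aestronglyMeasurable
  have hI' : ∫ u in (0 : ℝ)..π, g u = (-(π : ℂ) * Complex.I) * Z α := by
    refine hI.unique ?_
    simp only [hFint]
    exact (summable_norm_mul_pow ha (norm_exp_mul_I α).le).of_norm.hasSum.mul_left _
  have hre : ∀ u, ((Z (α - u)).re - (Z (α + u)).re) * halfCot u = (g u).re := fun u => by
    simp [hg, Complex.mul_re]
  have hreI : ∫ u in (0 : ℝ)..π, (g u).re = (∫ u in (0 : ℝ)..π, g u).re :=
    Complex.reCLM.intervalIntegral_comp_comm hgi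
  rw [periodicHilbert_eq_integral (f := fun x => (Z x).re) (Complex.continuous_re.comp hZc)]
  · simp only [hre]
    rw [hreI, hI']
    simp only [Complex.mul_re, Complex.mul_im, Complex.neg_re, Complex.neg_im, Complex.ofReal_re,
      Complex.ofReal_im, Complex.I_re, Complex.I_im]
    have := pi_pos.ne'
    field_simp
    simp [hZ]
  · simp only [hre]
    rw [intervalIntegrable_iff_integrableOn_Ioc_of_le pi_pos.le] at hgi ⊢
    exact hgi.re

/-! ### Fourier coefficients and Sobolev functions -/

/-- The coefficients `2 f̂(n)`, `n ≥ 0`, of the holomorphic function in the disc whose real part has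
the boundary values `f`, for `f` of mean zero. -/
noncomputable def hardyCoeff (f : ℝ → ℝ) (n : ℕ) : ℂ :=
  2 * fourierCoeffOn Real.two_pi_pos (fun x => (f x : ℂ)) n

lemma fourierCoeffOn_two_pi_eq_integral (f : ℝ → ℝ) (n : ℤ) :
    fourierCoeffOn Real.two_pi_pos (fun x => (f x : ℂ)) n =
      (1 / (2 * π) : ℂ) * ∫ x in (0 : ℝ)..2 * π, (f x : ℂ) * Complex.exp (-(n * x) * Complex.I) := by
  rw [fourierCoeffOn_eq_integral, Complex.real_smul]
  congr 1
  · simp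
  · refine intervalIntegral.integral_congr fun x _ => ?_
    simp only [fourier_coe_apply, smul_eq_mul]
    rw [mul_comm]
    congr 2
    have : (π : ℂ) ≠ 0 := by exact_mod_cast pi_ne_zero
    push_cast
    field_simp
    ring

lemma fourierCoeffOn_two_pi_sub {f g : ℝ → ℝ} (hf : Continuous f) (hg : Continuous g) (n : ℤ) :
    fourierCoeffOn Real.two_pi_pos (fun x => ((f x - g x : ℝ) : ℂ)) n =
      fourierCoeffOn Real.two_pi_pos (fun x => (f x : ℂ)) n -
        fourierCoeffOn Real.two_pi_pos (fun x => (g x : ℂ)) n := by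
  rw [fourierCoeffOn_two_pi_eq_integral (fun x => f x - g x), fourierCoeffOn_two_pi_eq_integral f,
    fourierCoeffOn_two_pi_eq_integral g, ← mul_sub, ← intervalIntegral.integral_sub
      (Continuous.intervalIntegrable (by fun_prop) _ _)
      (Continuous.intervalIntegrable (by fun_prop) _ _)]
  simp only [Complex.ofReal_sub, sub_mul]

lemma fourierCoeffOn_two_pi_neg (f : ℝ → ℝ) (n : ℤ) :
    fourierCoeffOn Real.two_pi_pos (fun x => (f x : ℂ)) (-n) =
      (starRingEnd ℂ) (fourierCoeffOn Real.two_pi_pos (fun x => (f x : ℂ)) n) := by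
  rw [fourierCoeffOn_two_pi_eq_integral, fourierCoeffOn_two_pi_eq_integral, map_mul,
    ← intervalIntegral.intervalIntegral_conj]
  congr 1
  · simp [Complex.conj_ofNat]
  · refine intervalIntegral.integral_congr fun x _ => ?_
    simp only [map_mul, Complex.conj_ofReal, ← Complex.exp_conj, map_neg, Complex.conj_I,
      map_intCast, Int.cast_neg]
    ring_nf

lemma MemPeriodicSobolev.sub {s : ℝ} {f g : ℝ → ℝ} (hf : MemPeriodicSobolev s f)
    (hg : MemPeriodicSobolev s g) : MemPeriodicSobolev s fun x => f x - g x where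
  periodic := hf.periodic.sub hg.periodic
  continuous := hf.continuous.sub hg.continuous
  summable := by
    refine ((hf.summable.mul_left 2).add (hg.summable.mul_left 2)).of_nonneg_of_le
      (fun n => by positivity) fun n => ?_
    rw [fourierCoeffOn_two_pi_sub hf.continuous hg.continuous]
    generalize fourierCoeffOn Real.two_pi_pos (fun x => (f x : ℂ)) n = c
    generalize fourierCoeffOn Real.two_pi_pos (fun x => (g x : ℂ)) n = d
    have h1 : ‖c - d‖ ^ 2 ≤ 2 * ‖c‖ ^ 2 + 2 * ‖d‖ ^ 2 := by
      have := norm_sub_le c d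
      nlinarith [sq_nonneg (‖c‖ - ‖d‖), norm_nonneg (c - d)]
    calc (1 + (n : ℝ) ^ 2) ^ s * ‖c - d‖ ^ 2 ≤
          (1 + (n : ℝ) ^ 2) ^ s * (2 * ‖c‖ ^ 2 + 2 * ‖d‖ ^ 2) := by gcongr
      _ = _ := by ring

lemma summable_one_add_sq_rpow {r : ℝ} (hr : r < -(1 / 2)) :
    Summable fun n : ℤ => (1 + (n : ℝ) ^ 2) ^ r := by
  have h := Real.summable_abs_int_rpow (b := -(2 * r)) (by linarith)
  refine Summable.of_norm_bounded_eventually h ?_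
  filter_upwards [(Set.finite_singleton (0 : ℤ)).compl_mem_cofinite] with n hn
  have hn' : (0 : ℝ) < |(n : ℝ)| := abs_pos.2 (by exact_mod_cast hn)
  rw [Real.norm_of_nonneg (by positivity), neg_neg, Real.rpow_mul hn'.le]
  refine Real.rpow_le_rpow_of_nonpos (by positivity) ?_ (by linarith)
  rw [Real.rpow_two, sq_abs]
  linarith

/-- The Sobolev embedding `H^s ⊂ A¹`, `s > 3/2`, where `A¹` is the Wiener algebra of functions with
`∑ (1 + |n|) |f̂(n)| < ∞`. -/
lemma exists_wiener_bound {s : ℝ} (hs : 3 / 2 < s) : ∃ C : ℝ, 0 ≤ C ∧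
    ∀ f : ℝ → ℝ, MemPeriodicSobolev s f →
      (Summable fun n : ℤ => (1 + |(n : ℝ)|) *
        ‖fourierCoeffOn Real.two_pi_pos (fun x => (f x : ℂ)) n‖) ∧
      ∑' n : ℤ, (1 + |(n : ℝ)|) * ‖fourierCoeffOn Real.two_pi_pos (fun x => (f x : ℂ)) n‖ ≤
        periodicSobolevNorm s f * C := by
  -- Cauchy–Schwarz against the weight `g`, which is square-summable exactly when `s > 3/2`.
  set g : ℤ → ℝ := fun n => (1 + |(n : ℝ)|) * (1 + (n : ℝ) ^ 2) ^ (-(s / 2)) with hg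
  have hpos : ∀ n : ℤ, (0 : ℝ) < 1 + (n : ℝ) ^ 2 := fun n => by positivity
  have hgs : Summable fun n => g n ^ (2 : ℝ) := by
    refine ((summable_one_add_sq_rpow (r := 1 - s) (by linarith)).mul_left 2).of_nonneg_of_le
      (fun n => by positivity) fun n => ?_
    rw [Real.rpow_two, hg, mul_pow, ← Real.rpow_two ((1 + (n : ℝ) ^ 2) ^ (-(s / 2))),
      ← Real.rpow_mul (hpos n).le, sub_eq_add_neg, Real.rpow_add (hpos n), Real.rpow_one,
      show -(s / 2) * 2 = -s by ring, ← mul_assoc]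
    refine mul_le_mul_of_nonneg_right ?_ (by positivity)
    nlinarith [sq_abs (n : ℝ), sq_nonneg (|(n : ℝ)| - 1)]
  refine ⟨(∑' n, g n ^ (2 : ℝ)) ^ (1 / (2 : ℝ)), by positivity, fun f hf => ?_⟩
  set c := fourierCoeffOn Real.two_pi_pos (fun x => (f x : ℂ)) with hc
  set F : ℤ → ℝ := fun n => (1 + (n : ℝ) ^ 2) ^ (s / 2) * ‖c n‖ with hF
  have hFsq : ∀ n, F n ^ (2 : ℝ) = (1 + (n : ℝ) ^ 2) ^ s * ‖c n‖ ^ 2 := fun n => by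
    rw [Real.rpow_two, hF, mul_pow, ← Real.rpow_two ((1 + (n : ℝ) ^ 2) ^ (s / 2)),
      ← Real.rpow_mul (hpos n).le, div_mul_cancel₀ _ two_ne_zero]
  have hFs : Summable fun n => F n ^ (2 : ℝ) := by
    simp only [hFsq]
    exact hf.summable
  have hFg : ∀ n, F n * g n = (1 + |(n : ℝ)|) * ‖c n‖ := fun n => by
    have : (1 + (n : ℝ) ^ 2) ^ (s / 2) * (1 + (n : ℝ) ^ 2) ^ (-(s / 2)) = 1 := by
      rw [← Real.rpow_add (hpos n), add_neg_cancel, Real.rpow_zero]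
    simp only [hF, hg]
    linear_combination ((1 + |(n : ℝ)|) * ‖c n‖) * this
  have hol := Real.summable_and_inner_le_Lp_mul_Lq_tsum_of_nonneg Real.HolderConjugate.two_two
    (f := F) (g := g) (fun n => by positivity) (fun n => by positivity) hFs hgs
  simp only [hFg, hFsq] at hol
  rw [← Real.sqrt_eq_rpow (∑' n : ℤ, (1 + (n : ℝ) ^ 2) ^ s * ‖c n‖ ^ 2)] at hol
  exact hol

lemma exists_hardyCoeff_bound {s : ℝ} (hs : 3 / 2 < s) : ∃ C : ℝ, 0 ≤ C ∧
    ∀ f : ℝ → ℝ, MemPeriodicSobolev s f →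
      (Summable fun n : ℕ => (1 + (n : ℝ)) * ‖hardyCoeff f n‖) ∧
      ∑' n : ℕ, (1 + (n : ℝ)) * ‖hardyCoeff f n‖ ≤ C * periodicSobolevNorm s f := by
  obtain ⟨C, hC, h⟩ := exists_wiener_bound hs
  refine ⟨2 * C, by positivity, fun f hf => ?_⟩
  obtain ⟨h1, h2⟩ := h f hf
  have heq : ∀ n : ℕ, (1 + (n : ℝ)) * ‖hardyCoeff f n‖ = 2 * ((1 + |((n : ℤ) : ℝ)|) *
      ‖fourierCoeffOn Real.two_pi_pos (fun x => (f x : ℂ)) (n : ℤ)‖) := fun n => by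
    rw [hardyCoeff, norm_mul, Int.cast_natCast, Nat.abs_cast, Complex.norm_two]
    ring
  have hinj : Function.Injective ((↑) : ℕ → ℤ) := Nat.cast_injective
  simp only [heq]
  refine ⟨(h1.comp_injective hinj).mul_left 2, ?_⟩
  rw [tsum_mul_left]
  have h3 : ∑' n : ℕ, (1 + |((n : ℤ) : ℝ)|) *
      ‖fourierCoeffOn Real.two_pi_pos (fun x => (f x : ℂ)) (n : ℤ)‖ ≤ ∑' n : ℤ, (1 + |(n : ℝ)|) *
        ‖fourierCoeffOn Real.two_pi_pos (fun x => (f x : ℂ)) n‖ :=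
    Summable.tsum_le_tsum_of_inj _ hinj (fun n _ => by positivity) (fun _ => le_rfl)
      (h1.comp_injective hinj) h1
  linarith

/-- A mean-zero function of class `H^s`, `s > 3/2`, is the real part of the boundary values of the
holomorphic function with coefficients `hardyCoeff f`. -/
lemma re_powerSum_hardyCoeff {s : ℝ} (hs : 3 / 2 < s) {f : ℝ → ℝ} (hf : MemPeriodicSobolev s f)
    (h0 : hardyCoeff f 0 = 0) (x : ℝ) :
    (powerSum (hardyCoeff f) (Complex.exp (x * Complex.I))).re = f x := by
  have : Fact (0 < 2 * π) := ⟨two_pi_pos⟩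
  obtain ⟨C, -, hC⟩ := exists_wiener_bound hs
  obtain ⟨D, -, hD⟩ := exists_hardyCoeff_bound hs
  have hper : Function.Periodic (fun x => (f x : ℂ)) (2 * π) := fun x => by
    simp only [hf.periodic x]
  set c := fourierCoeffOn Real.two_pi_pos (fun x => (f x : ℂ)) with hc
  have hcont : Continuous (hper.lift) := by
    have : Continuous fun x => (f x : ℂ) := by have := hf.continuous; fun_prop
    exact continuous_coinduced_dom.2 this
  let F : C(AddCircle (2 * π), ℂ) := ⟨hper.lift, hcont⟩
  have hFc : fourierCoeff F = c := by
    ext n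
    rw [fourierCoeff_eq_intervalIntegral _ _ 0, hc, fourierCoeffOn_eq_integral]
    simp only [zero_add, sub_zero]
    refine congrArg _ (intervalIntegral.integral_congr fun y _ => ?_)
    simp only [fourier_coe_apply, sub_zero]
    rfl
  have hsum : Summable c := by
    refine Summable.of_norm (f := c) (Summable.of_nonneg_of_le (fun n => norm_nonneg _)
      (fun n => ?_) (hC f hf).1)
    exact le_mul_of_one_le_left (norm_nonneg _) (by linarith [abs_nonneg (n : ℝ)])
  have h := has_pointwise_sum_fourier_series_of_summable (f := F) (by rw [hFc]; exact hsum)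
    (x : AddCircle (2 * π))
  rw [hFc] at h
  have hc0 : c 0 = 0 := by simpa [hardyCoeff] using h0
  have h2 := h.nat_add_neg
  simp only [hc0, smul_eq_mul] at h2
  rw [zero_mul, add_zero] at h2
  have hterm : ∀ n : ℕ, c n * fourier n (x : AddCircle (2 * π)) +
      c (-n) * fourier (-n) (x : AddCircle (2 * π)) =
      ((hardyCoeff f n * Complex.exp (x * Complex.I) ^ n).re : ℂ) := by
    intro n
    have hexp : (fourier n (x : AddCircle (2 * π)) : ℂ) = Complex.exp (x * Complex.I) ^ n := by
      rw [fourier_coe_apply, ← Complex.exp_nat_mul]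
      have : (π : ℂ) ≠ 0 := by exact_mod_cast pi_ne_zero
      congr 1
      push_cast
      field_simp
    rw [hc, fourierCoeffOn_two_pi_neg, fourier_neg, ← map_mul, Complex.add_conj, hardyCoeff, hexp,
      mul_assoc, ← Complex.ofReal_ofNat, Complex.re_ofReal_mul]
  simp only [hterm] at h2
  have hs1 : Summable fun n => ‖hardyCoeff f n‖ :=
    (hD f hf).1.of_nonneg_of_le (fun _ => norm_nonneg _) fun n =>
      le_mul_of_one_le_left (norm_nonneg _) (by simp)
  have h3 := Complex.hasSum_re (summable_norm_mul_pow hs1 (norm_exp_mul_I x).le).of_norm.hasSum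
  exact h3.unique (Complex.hasSum_ofReal.1 h2)

/-! ### Fourier modes of solutions -/

lemma integral_cexp_int_mul_I (m : ℤ) :
    ∫ x in (0 : ℝ)..2 * π, Complex.exp (m * x * Complex.I) = if m = 0 then 2 * (π : ℂ) else 0 := by
  rcases eq_or_ne m 0 with rfl | hm
  · simp
  · have hc : (m : ℂ) * Complex.I ≠ 0 :=
      mul_ne_zero (by exact_mod_cast hm) Complex.I_ne_zero
    have h := integral_exp_mul_complex (a := 0) (b := 2 * π) hc
    have hrw : ∀ x : ℝ, (m : ℂ) * x * Complex.I = m * Complex.I * x := fun x => by ring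
    simp only [hrw]
    rw [h, if_neg hm]
    have h1 : (m : ℂ) * Complex.I * ((2 * π : ℝ) : ℂ) = m * (2 * π * Complex.I) := by
      push_cast
      ring
    rw [h1, Complex.exp_int_mul_two_pi_mul_I]
    simp

/-- Orthogonality of the exponentials, applied to an absolutely convergent power series. -/
lemma integral_powerSum_mul_cexp {b : ℕ → ℂ} (hb : Summable fun n => ‖b n‖) (m : ℤ) :
    ∫ x in (0 : ℝ)..2 * π, powerSum b (Complex.exp (x * Complex.I)) *
      Complex.exp (m * x * Complex.I) = ∑' k : ℕ, if (k : ℤ) + m = 0 then 2 * π * b k else 0 := by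
  have hterm : ∀ (k : ℕ) (x : ℝ), b k * Complex.exp (x * Complex.I) ^ k *
      Complex.exp (m * x * Complex.I) = b k * Complex.exp (((k : ℤ) + m : ℤ) * x * Complex.I) := by
    intro k x
    rw [mul_assoc, ← Complex.exp_nat_mul, ← Complex.exp_add]
    congr 2
    push_cast
    ring
  have hnorm : ∀ x : ℝ, ‖Complex.exp (m * x * Complex.I)‖ = 1 := fun x => by
    have := norm_exp_mul_I (m * x)
    push_cast at this
    exact this
  have hI := intervalIntegral.hasSum_integral_of_dominated_convergence (μ := volume) (a := 0)
    (b := 2 * π) (F := fun k x => b k * Complex.exp (x * Complex.I) ^ k *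
      Complex.exp (m * x * Complex.I))
    (f := fun x => powerSum b (Complex.exp (x * Complex.I)) * Complex.exp (m * x * Complex.I))
    (fun k _ => ‖b k‖) (fun k => Continuous.aestronglyMeasurable (by fun_prop))
    (fun k => ae_of_all _ fun x _ => ?_) (ae_of_all _ fun _ _ => hb) intervalIntegrable_const
    (ae_of_all _ fun x _ => ?_)
  · rw [← hI.tsum_eq]
    refine tsum_congr fun k => ?_
    simp only [hterm]
    rw [intervalIntegral.integral_const_mul, integral_cexp_int_mul_I]
    split_ifs <;> ring
  · rw [norm_mul, hnorm, mul_one]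
    exact norm_mul_pow_le (norm_exp_mul_I x).le k
  · exact (summable_norm_mul_pow hb (norm_exp_mul_I x).le).of_norm.hasSum.mul_right _

lemma integral_powerSum_mul_cexp_neg {b : ℕ → ℂ} (hb : Summable fun n => ‖b n‖) (n : ℕ) :
    ∫ x in (0 : ℝ)..2 * π, powerSum b (Complex.exp (x * Complex.I)) *
      Complex.exp (-(n * x) * Complex.I) = 2 * π * b n := by
  have h := integral_powerSum_mul_cexp hb (-(n : ℤ))
  have h1 : ∀ x : ℝ, ((-(n : ℤ) : ℤ) : ℂ) * x * Complex.I = -(n * x) * Complex.I := fun x => by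
    push_cast
    ring
  simp only [h1] at h
  rw [h, tsum_eq_single n]
  · simp
  · intro k hk
    rw [if_neg]
    omega

lemma integral_powerSum_mul_cexp_pos {b : ℕ → ℂ} (hb : Summable fun n => ‖b n‖) {n : ℕ}
    (hn : n ≠ 0) :
    ∫ x in (0 : ℝ)..2 * π, powerSum b (Complex.exp (x * Complex.I)) *
      Complex.exp (n * x * Complex.I) = 0 := by
  have h := integral_powerSum_mul_cexp hb (n : ℤ)
  rw [Int.cast_natCast] at h
  rw [h]
  refine (tsum_congr fun k => ?_).trans tsum_zero
  rw [if_neg]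
  omega

lemma continuous_powerSum_circle {b : ℕ → ℂ} (hb : Summable fun n => ‖b n‖) :
    Continuous fun x : ℝ => powerSum b (Complex.exp (x * Complex.I)) :=
  (continuousOn_powerSum hb).comp_continuous (by fun_prop) fun x => by
    simp

/-- The positive Fourier modes of the imaginary part of a power series: the conjugate series has
only non-positive modes. -/
lemma integral_im_powerSum_mul_cexp_neg {b : ℕ → ℂ} (hb : Summable fun n => ‖b n‖) {n : ℕ}
    (hn : n ≠ 0) :
    ∫ x in (0 : ℝ)..2 * π, ((powerSum b (Complex.exp (x * Complex.I))).im : ℂ) *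
      Complex.exp (-(n * x) * Complex.I) = -(π * Complex.I * b n) := by
  have hB := continuous_powerSum_circle hb
  have h1 := integral_powerSum_mul_cexp_neg hb n
  have h2 : ∫ x in (0 : ℝ)..2 * π, (starRingEnd ℂ) (powerSum b (Complex.exp (x * Complex.I))) *
      Complex.exp (-(n * x) * Complex.I) = 0 := by
    have h3 := congrArg (starRingEnd ℂ) (integral_powerSum_mul_cexp_pos hb hn)
    rw [← intervalIntegral.intervalIntegral_conj, map_zero] at h3
    rw [← h3]
    refine intervalIntegral.integral_congr fun x _ => ?_
    simp only [map_mul, ← Complex.exp_conj, Complex.conj_ofReal, Complex.conj_I, Complex.conj_natCast]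
    ring_nf
  have h3 : ∀ x : ℝ, ((powerSum b (Complex.exp (x * Complex.I))).im : ℂ) *
      Complex.exp (-(n * x) * Complex.I) = -(Complex.I / 2) *
        (powerSum b (Complex.exp (x * Complex.I)) * Complex.exp (-(n * x) * Complex.I) -
        (starRingEnd ℂ) (powerSum b (Complex.exp (x * Complex.I))) *
          Complex.exp (-(n * x) * Complex.I)) := by
    intro x
    rw [Complex.im_eq_sub_conj]
    field_simp
    rw [Complex.I_sq]
    ring
  simp only [h3]
  rw [intervalIntegral.integral_const_mul, intervalIntegral.integral_sub
    (Continuous.intervalIntegrable (by fun_prop) _ _)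
    (Continuous.intervalIntegrable (by fun_prop) _ _), h1, h2]
  ring

lemma integral_ofReal_mul_cexp_neg {f : ℝ → ℝ} (hf : Continuous f) (n : ℕ) :
    ∫ x in (0 : ℝ)..2 * π, (f x : ℂ) * Complex.exp (-(n * x) * Complex.I) =
      ((∫ x in (0 : ℝ)..2 * π, f x * cos (n * x) : ℝ) : ℂ) -
        (∫ x in (0 : ℝ)..2 * π, f x * sin (n * x) : ℝ) * Complex.I := by
  rw [← intervalIntegral.integral_ofReal, ← intervalIntegral.integral_ofReal,
    ← intervalIntegral.integral_mul_const, ← intervalIntegral.integral_sub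
    (Continuous.intervalIntegrable (by fun_prop) _ _)
    (Continuous.intervalIntegrable (by fun_prop) _ _)]
  refine intervalIntegral.integral_congr fun x _ => ?_
  rw [Complex.exp_mul_I, Complex.cos_neg, Complex.sin_neg]
  push_cast
  ring

lemma hardyCoeff_eq {f : ℝ → ℝ} (hf : Continuous f) (n : ℕ) :
    hardyCoeff f n = (1 / π : ℂ) * (((∫ x in (0 : ℝ)..2 * π, f x * cos (n * x) : ℝ) : ℂ) -
      (∫ x in (0 : ℝ)..2 * π, f x * sin (n * x) : ℝ) * Complex.I) := by
  have : (π : ℂ) ≠ 0 := by exact_mod_cast pi_ne_zero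
  rw [← integral_ofReal_mul_cexp_neg hf, hardyCoeff, fourierCoeffOn_two_pi_eq_integral,
    Int.cast_natCast, ← mul_assoc]
  congr 1
  field_simp

lemma hardyCoeff_sub {f g : ℝ → ℝ} (hf : Continuous f) (hg : Continuous g) (n : ℕ) :
    hardyCoeff (fun x => f x - g x) n = hardyCoeff f n - hardyCoeff g n := by
  rw [hardyCoeff, fourierCoeffOn_two_pi_sub hf hg, mul_sub]
  rfl

/-- The weak equation, tested with `cos (n σ)` and `sin (n σ)`. -/
lemma IsAmplitudeSolution.hasDerivAt_hardyCoeff {s T : ℝ} {w₀ : ℝ → ℝ} {w : ℝ → ℝ → ℝ}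
    (h : IsAmplitudeSolution s T w₀ w) {t : ℝ} (ht : t ∈ Ioo 0 T) (n : ℕ) :
    HasDerivAt (fun r => hardyCoeff (w r) n) ((1 / π : ℂ) *
      (((n / 2 * ∫ x in (0 : ℝ)..2 * π, w t x * periodicHilbert (w t) x * sin (n * x) : ℝ) : ℂ) +
      (n / 2 * ∫ x in (0 : ℝ)..2 * π, w t x * periodicHilbert (w t) x * cos (n * x) : ℝ) *
        Complex.I)) t := by
  have hper : ∀ x : ℝ, (n : ℝ) * (x + 2 * π) = n * x + n * (2 * π) := fun x => by ring
  have hc := h.equation (fun x => cos (n * x)) (by fun_prop)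
    (fun x => by simp only [hper, cos_add_nat_mul_two_pi]) t ht
  have hs := h.equation (fun x => sin (n * x)) (by fun_prop)
    (fun x => by simp only [hper, sin_add_nat_mul_two_pi]) t ht
  have hdc : ∀ x : ℝ, deriv (fun x : ℝ => cos (n * x)) x = -n * sin (n * x) := fun x => by
    simp [mul_comm]
  have hds : ∀ x : ℝ, deriv (fun x : ℝ => sin (n * x)) x = n * cos (n * x) := fun x => by
    simp [mul_comm]
  have hmain := (hc.ofReal_comp.sub (hs.ofReal_comp.mul_const Complex.I)).const_mul (1 / π : ℂ)
  have hev : (fun r => hardyCoeff (w r) n) =ᶠ[𝓝 t] fun r => (1 / π : ℂ) *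
      (((∫ x in (0 : ℝ)..2 * π, w r x * cos (n * x) : ℝ) : ℂ) -
      (∫ x in (0 : ℝ)..2 * π, w r x * sin (n * x) : ℝ) * Complex.I) := by
    filter_upwards [isOpen_Ioo.mem_nhds ht] with r hr
    exact hardyCoeff_eq (h.class_mem.mem r (Ioo_subset_Ico_self hr)).continuous n
  refine (HasDerivAt.congr_of_eventuallyEq hmain hev).congr_deriv ?_
  congr 1
  have e1 : ∀ x, w t x * periodicHilbert (w t) x * (-n * sin (n * x)) =
      -n * (w t x * periodicHilbert (w t) x * sin (n * x)) := fun x => by ring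
  have e2 : ∀ x, w t x * periodicHilbert (w t) x * (n * cos (n * x)) =
      n * (w t x * periodicHilbert (w t) x * cos (n * x)) := fun x => by ring
  simp only [hdc, hds, e1, e2]
  rw [intervalIntegral.integral_const_mul, intervalIntegral.integral_const_mul]
  push_cast
  ring

lemma summable_of_summable_one_add_mul {a : ℕ → ℂ} (h : Summable fun n : ℕ => (1 + (n : ℝ)) * ‖a n‖) :
    (Summable fun n => ‖a n‖) ∧ (Summable fun n : ℕ => ‖(n : ℂ) * a n‖) ∧
      ∑' n, ‖a n‖ ≤ ∑' n : ℕ, (1 + (n : ℝ)) * ‖a n‖ ∧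
      ∑' n : ℕ, ‖(n : ℂ) * a n‖ ≤ ∑' n : ℕ, (1 + (n : ℝ)) * ‖a n‖ := by
  have b1 : ∀ n : ℕ, ‖a n‖ ≤ (1 + (n : ℝ)) * ‖a n‖ := fun n =>
    le_mul_of_one_le_left (norm_nonneg _) (by simp)
  have b2 : ∀ n : ℕ, ‖(n : ℂ) * a n‖ ≤ (1 + (n : ℝ)) * ‖a n‖ := fun n => by
    rw [norm_mul, Complex.norm_natCast]
    gcongr
    simp
  have h1 := h.of_nonneg_of_le (fun _ => norm_nonneg _) b1
  have h2 := h.of_nonneg_of_le (fun _ => norm_nonneg _) b2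
  exact ⟨h1, h2, h1.tsum_le_tsum b1 h, h2.tsum_le_tsum b2 h⟩

/-- For a mean-zero function `f` with analytic completion `F = f + i H f`, the product `f H f` is
`Im (F²) / 2`. -/
lemma mul_periodicHilbert {s : ℝ} (hs : 3 / 2 < s) {f : ℝ → ℝ} (hf : MemPeriodicSobolev s f)
    (h0 : hardyCoeff f 0 = 0) (x : ℝ) :
    f x * periodicHilbert f x =
      (powerSum (squareCoeff (hardyCoeff f)) (Complex.exp (x * Complex.I))).im / 2 := by
  obtain ⟨C, -, hC⟩ := exists_hardyCoeff_bound hs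
  obtain ⟨h1, h2, -, -⟩ := summable_of_summable_one_add_mul (hC f hf).1
  have hre := re_powerSum_hardyCoeff hs hf h0
  have hfun : (fun x : ℝ => (powerSum (hardyCoeff f) (Complex.exp (x * Complex.I))).re) = f :=
    funext hre
  have hH := periodicHilbert_re_powerSum h0 h1 h2 x
  rw [hfun] at hH
  rw [powerSum_squareCoeff h1 (norm_exp_mul_I x).le, hH, ← hre x, sq, Complex.mul_im]
  ring

/-- The Fourier modes of a mean-zero solution satisfy the triangular system
`aₙ' = (n / 4) ∑_{k + l = n} aₖ aₗ`. -/
lemma IsAmplitudeSolution.hasDerivAt_hardyCoeff_of_mean_zero {s T : ℝ} (hs : 3 / 2 < s)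
    {w₀ : ℝ → ℝ} {w : ℝ → ℝ → ℝ} (h : IsAmplitudeSolution s T w₀ w) {t : ℝ} (ht : t ∈ Ioo 0 T)
    (h0 : hardyCoeff (w t) 0 = 0) (n : ℕ) :
    HasDerivAt (fun r => hardyCoeff (w r) n)
      ((n : ℂ) / 4 * squareCoeff (hardyCoeff (w t)) n) t := by
  refine (h.hasDerivAt_hardyCoeff ht n).congr_deriv ?_
  rcases eq_or_ne n 0 with rfl | hn
  · simp
  have hm := h.class_mem.mem t (Ioo_subset_Ico_self ht)
  obtain ⟨C, -, hC⟩ := exists_hardyCoeff_bound hs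
  have hsq := summable_norm_squareCoeff (summable_of_summable_one_add_mul (hC _ hm).1).1
  have hint := integral_im_powerSum_mul_cexp_neg hsq hn
  have hcont : Continuous fun x : ℝ =>
      (powerSum (squareCoeff (hardyCoeff (w t))) (Complex.exp (x * Complex.I))).im :=
    Complex.continuous_im.comp (continuous_powerSum_circle hsq)
  rw [integral_ofReal_mul_cexp_neg hcont] at hint
  simp only [mul_periodicHilbert hs hm h0, div_mul_eq_mul_div]
  rw [intervalIntegral.integral_div, intervalIntegral.integral_div]
  have hpi : (π : ℂ) ≠ 0 := by exact_mod_cast pi_ne_zero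
  generalize (∫ x in (0 : ℝ)..2 * π, (powerSum (squareCoeff (hardyCoeff (w t)))
    (Complex.exp (x * Complex.I))).im * cos (n * x)) = A at *
  generalize (∫ x in (0 : ℝ)..2 * π, (powerSum (squareCoeff (hardyCoeff (w t)))
    (Complex.exp (x * Complex.I))).im * sin (n * x)) = B at *
  push_cast
  field_simp
  linear_combination (4 * Complex.I) * hint + 4 * (B - π * squareCoeff (hardyCoeff (w t)) n) * Complex.I_sq

/-- The `ℓ¹` distance of the modes to their initial values tends to zero. -/
lemma IsAmplitudeSolution.tendsto_hardyCoeff {s T : ℝ} (hs : 3 / 2 < s) (hT : 0 < T)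
    {w₀ : ℝ → ℝ} {w : ℝ → ℝ → ℝ} (h : IsAmplitudeSolution s T w₀ w) :
    Tendsto (fun t => ∑' n : ℕ, (1 + (n : ℝ)) * ‖hardyCoeff (w t) n - hardyCoeff (w 0) n‖)
      (𝓝[>] 0) (𝓝 0) := by
  obtain ⟨C, -, hC⟩ := exists_hardyCoeff_bound hs
  have h0 : (0 : ℝ) ∈ Ico 0 T := ⟨le_rfl, hT⟩
  have hlim := ((h.class_mem.tendsto 0 h0).const_mul C).mono_left
    (nhdsWithin_mono 0 (Ioo_subset_Ico_self : Ioo 0 T ⊆ Ico 0 T))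
  rw [nhdsWithin_Ioo_eq_nhdsGT hT, mul_zero] at hlim
  refine squeeze_zero' (Eventually.of_forall fun t => tsum_nonneg fun n => by positivity) ?_ hlim
  filter_upwards [Ioo_mem_nhdsGT hT] with t ht
  have hm := h.class_mem.mem t (Ioo_subset_Ico_self ht)
  have hm0 := h.class_mem.mem 0 h0
  have := (hC _ (hm.sub hm0)).2
  simpa only [hardyCoeff_sub hm.continuous hm0.continuous] using this

lemma IsAmplitudeSolution.summable_sub {s T : ℝ} (hs : 3 / 2 < s) {w₀ : ℝ → ℝ} {w : ℝ → ℝ → ℝ}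
    (h : IsAmplitudeSolution s T w₀ w) {t : ℝ} (ht : t ∈ Ico 0 T) :
    Summable fun n : ℕ => (1 + (n : ℝ)) * ‖hardyCoeff (w t) n - hardyCoeff (w 0) n‖ := by
  obtain ⟨C, -, hC⟩ := exists_hardyCoeff_bound hs
  have hm := h.class_mem.mem t ht
  have hm0 := h.class_mem.mem 0 ⟨le_rfl, ht.1.trans_lt ht.2⟩
  have := (hC _ (hm.sub hm0)).1
  simpa only [hardyCoeff_sub hm.continuous hm0.continuous] using this

/-- The mean is conserved. -/
lemma IsAmplitudeSolution.hardyCoeff_zero {s T : ℝ} (hs : 3 / 2 < s) {w₀ : ℝ → ℝ} {w : ℝ → ℝ → ℝ}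
    (h : IsAmplitudeSolution s T w₀ w) (h0 : hardyCoeff (w 0) 0 = 0) {t : ℝ} (ht : t ∈ Ico 0 T) :
    hardyCoeff (w t) 0 = 0 := by
  rcases ht.1.eq_or_lt with rfl | hpos
  · exact h0
  refine eq_zero_of_norm_deriv_le_of_tendsto (g := fun r => hardyCoeff (w r) 0) (K := 0)
    (fun r hr => h.hasDerivAt_hardyCoeff hr 0) (fun r _ => by simp) ?_ t ⟨hpos, ht.2⟩
  refine squeeze_zero_norm' ?_ (h.tendsto_hardyCoeff hs (hpos.trans ht.2))
  filter_upwards [Ioo_mem_nhdsGT (hpos.trans ht.2)] with r hr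
  have := (h.summable_sub hs (Ioo_subset_Ico_self hr)).le_tsum 0 fun _ _ => by positivity
  simpa [h0] using this

/-- The analytic completion of a mean-zero solution solves the complex Burgers equation
`∂ₜ F = ¼ ζ ∂_ζ (F²)` in the disc, on a short time interval. -/
lemma IsAmplitudeSolution.exists_isDiscSolution {s T : ℝ} (hs : 3 / 2 < s) (hT : 0 < T)
    {w₀ : ℝ → ℝ} {w : ℝ → ℝ → ℝ} (h : IsAmplitudeSolution s T w₀ w)
    (h0 : hardyCoeff (w 0) 0 = 0) :
    ∃ τ M : ℝ, 0 < τ ∧ IsDiscSolution τ M fun t => hardyCoeff (w t) := by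
  have hlim := h.tendsto_hardyCoeff hs hT
  obtain ⟨C, -, hC⟩ := exists_hardyCoeff_bound hs
  have h0T : (0 : ℝ) ∈ Ico 0 T := ⟨le_rfl, hT⟩
  have hev : ∀ᶠ t in 𝓝[>] (0 : ℝ), (∑' n : ℕ, (1 + (n : ℝ)) *
      ‖hardyCoeff (w t) n - hardyCoeff (w 0) n‖ < 1) ∧ t ∈ Ioo 0 T :=
    (hlim.eventually_lt_const one_pos).and (Ioo_mem_nhdsGT hT)
  obtain ⟨τ', hτ', hτ⟩ := (mem_nhdsGT_iff_exists_Ioo_subset).1 hev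
  have hτpos : 0 < min τ' T := lt_min hτ' hT
  have hsub : Ico 0 (min τ' T) ⊆ Ico 0 T := Ico_subset_Ico_right (min_le_right _ _)
  set S := ∑' n : ℕ, (1 + (n : ℝ)) * ‖hardyCoeff (w 0) n‖ with hS
  have hsum : ∀ t ∈ Ico 0 T, Summable fun n : ℕ => (1 + (n : ℝ)) * ‖hardyCoeff (w t) n‖ :=
    fun t ht => (hC _ (h.class_mem.mem t ht)).1
  have hbound : ∀ t ∈ Ico 0 (min τ' T),
      ∑' n : ℕ, (1 + (n : ℝ)) * ‖hardyCoeff (w t) n‖ ≤ S + 1 := by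
    intro t ht
    rcases ht.1.eq_or_lt with rfl | hpos
    · linarith
    have h1 := (hτ (show t ∈ Ioo 0 τ' from ⟨hpos, ht.2.trans_le (min_le_left _ _)⟩)).1
    have h2 := h.summable_sub hs (hsub ht)
    have h3 := (hsum t (hsub ht)).tsum_le_tsum (g := fun n : ℕ => (1 + (n : ℝ)) *
      ‖hardyCoeff (w 0) n‖ + (1 + (n : ℝ)) * ‖hardyCoeff (w t) n - hardyCoeff (w 0) n‖)
      (fun n => ?_) ((hsum 0 h0T).add h2)
    · rw [(hsum 0 h0T).tsum_add h2] at h3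
      linarith
    · rw [← mul_add]
      refine mul_le_mul_of_nonneg_left ?_ (by positivity)
      have := norm_add_le (hardyCoeff (w 0) n) (hardyCoeff (w t) n - hardyCoeff (w 0) n)
      rwa [add_sub_cancel] at this
  refine ⟨min τ' T, S + 1, hτpos, fun t ht => ?_, fun t ht => ?_, fun t ht => ?_, fun t ht => ?_,
    fun t ht n => ?_, ?_⟩
  · exact (summable_of_summable_one_add_mul (hsum t (hsub ht))).1
  · exact (summable_of_summable_one_add_mul (hsum t (hsub ht))).2.1
  · exact (summable_of_summable_one_add_mul (hsum t (hsub ht))).2.2.1.trans (hbound t ht)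
  · exact (summable_of_summable_one_add_mul (hsum t (hsub ht))).2.2.2.trans (hbound t ht)
  · exact h.hasDerivAt_hardyCoeff_of_mean_zero hs ⟨ht.1, ht.2.trans_le (min_le_right _ _)⟩
      (h.hardyCoeff_zero hs h0 (hsub (Ioo_subset_Ico_self ht))) n
  · refine squeeze_zero' (Eventually.of_forall fun t => tsum_nonneg fun n => norm_nonneg _) ?_ hlim
    filter_upwards [Ioo_mem_nhdsGT hT] with t ht
    exact (summable_of_summable_one_add_mul (a := fun n => hardyCoeff (w t) n - hardyCoeff (w 0) n)
      (h.summable_sub hs (Ioo_subset_Ico_self ht))).2.2.1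

/-! ### Regularity forced by existence, and a smooth datum without solution -/

/-- A mean-zero datum that admits a solution is real-analytic wherever it is positive. -/
theorem IsAmplitudeSolution.analyticAt_of_pos {s T : ℝ} (hs : 3 / 2 < s) (hT : 0 < T)
    {w₀ : ℝ → ℝ} {w : ℝ → ℝ → ℝ} (h : IsAmplitudeSolution s T w₀ w)
    (hmean : (∫ σ in (0 : ℝ)..2 * π, w₀ σ) = 0) {σ₀ : ℝ} (hpos : 0 < w₀ σ₀) :
    AnalyticAt ℝ w₀ σ₀ := by
  have hm := h.class_mem.mem 0 ⟨le_rfl, hT⟩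
  have h0 : hardyCoeff (w 0) 0 = 0 := by
    rw [hardyCoeff_eq hm.continuous, h.initial]
    simp [hmean]
  obtain ⟨τ, M, hτ, hd⟩ := h.exists_isDiscSolution hs hT h0
  have hre := re_powerSum_hardyCoeff hs hm h0
  have hfun : (fun x : ℝ => (powerSum (hardyCoeff (w 0)) (Complex.exp (x * Complex.I))).re) = w₀ := by
    rw [← h.initial]
    exact funext hre
  have ha := hd.analyticAt hτ (x₀ := σ₀) (by rw [hre, h.initial]; exact hpos)
  rw [← hfun]
  exact (Complex.reCLM.analyticAt _).comp ha

/-- The smooth datum `m - f`, where `f = exp (-1 / sin)` on `(0, π)`, `f = 0` on `[π, 2π]`, and `m` is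
the mean of `f`. It is positive at `0`, where `f` is flat but not analytic. -/
noncomputable def flatDatum (σ : ℝ) : ℝ :=
  (1 / (2 * π) * ∫ x in (0 : ℝ)..2 * π, expNegInvGlue (sin x)) - expNegInvGlue (sin σ)

lemma contDiff_expNegInvGlue_sin : ContDiff ℝ ∞ fun σ => expNegInvGlue (sin σ) :=
  expNegInvGlue.contDiff.comp contDiff_sin

lemma integral_flatDatum : ∫ σ in (0 : ℝ)..2 * π, flatDatum σ = 0 := by
  have hc := contDiff_expNegInvGlue_sin.continuous
  simp only [flatDatum]
  rw [intervalIntegral.integral_sub intervalIntegrable_const (hc.intervalIntegrable _ _),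
    intervalIntegral.integral_const]
  have := pi_pos.ne'
  simp
  field_simp
  simp

lemma flatDatum_zero_pos : 0 < flatDatum 0 := by
  have hc := contDiff_expNegInvGlue_sin.continuous
  have h : 0 < ∫ x in (0 : ℝ)..2 * π, expNegInvGlue (sin x) := by
    refine intervalIntegral.integral_pos two_pi_pos hc.continuousOn
      (fun x _ => expNegInvGlue.nonneg _) ⟨π / 2, ⟨by positivity, by linarith [pi_pos]⟩, ?_⟩
    rw [sin_pi_div_two]
    exact expNegInvGlue.pos_of_pos one_pos
  simp only [flatDatum, sin_zero, expNegInvGlue.zero, sub_zero]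
  positivity

/-- The datum is constant on an interval to the left of `0`, and strictly smaller than this constant to
the right. -/
lemma not_analyticAt_flatDatum : ¬ AnalyticAt ℝ flatDatum 0 := by
  intro h
  have hf : AnalyticAt ℝ (fun σ => expNegInvGlue (sin σ)) 0 := by
    have : (fun σ => expNegInvGlue (sin σ)) = fun σ =>
        (1 / (2 * π) * ∫ x in (0 : ℝ)..2 * π, expNegInvGlue (sin x)) - flatDatum σ := by
      ext σ
      simp [flatDatum]
    rw [this]
    exact analyticAt_const.sub h
  have hleft : ∃ᶠ σ in 𝓝[≠] (0 : ℝ), expNegInvGlue (sin σ) = 0 := by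
    have h1 : ∀ᶠ σ in 𝓝[<] (0 : ℝ), expNegInvGlue (sin σ) = 0 := by
      filter_upwards [Ioo_mem_nhdsLT (show -π < 0 by linarith [pi_pos])] with σ hσ
      exact expNegInvGlue.zero_of_nonpos (sin_nonpos_of_nonpos_of_neg_pi_le hσ.2.le hσ.1.le)
    exact h1.frequently.filter_mono (nhdsWithin_mono 0 fun x hx => (mem_Iio.1 hx).ne)
  have hzero := hf.frequently_zero_iff_eventually_zero.1 hleft
  have hright : ∀ᶠ σ in 𝓝[>] (0 : ℝ), expNegInvGlue (sin σ) ≠ 0 := by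
    filter_upwards [Ioo_mem_nhdsGT pi_pos] with σ hσ
    exact (expNegInvGlue.pos_of_pos (sin_pos_of_pos_of_lt_pi hσ.1 hσ.2)).ne'
  obtain ⟨σ, h1, h2⟩ := ((hzero.filter_mono nhdsWithin_le_nhds).and hright).exists
  exact h2 h1

theorem mainTheorem2 :
    (∀ (s : ℝ) (w₀ : ℝ → ℝ), 3 / 2 < s → MemPeriodicSobolev s w₀ →
      (∫ σ in (0 : ℝ)..2 * π, w₀ σ) = 0 →
      (∃ σ₀ : ℝ, 0 < w₀ σ₀ ∧ ∀ U ∈ 𝓝 σ₀, ¬ ContDiffOn ℝ ∞ w₀ U) →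
      ∀ T : ℝ, 0 < T → ¬ ∃ w : ℝ → ℝ → ℝ, IsAmplitudeSolution s T w₀ w) ∧
    (∃ w₀ : ℝ → ℝ, ContDiff ℝ ∞ w₀ ∧ Function.Periodic w₀ (2 * π) ∧
      (∫ σ in (0 : ℝ)..2 * π, w₀ σ) = 0 ∧
      ∀ s T : ℝ, 3 / 2 < s → 0 < T → ¬ ∃ w : ℝ → ℝ → ℝ, IsAmplitudeSolution s T w₀ w) := by
  constructor
  · rintro s w₀ hs - hmean ⟨σ₀, hpos, hU⟩ T hT ⟨w, hw⟩
    have ha := hw.analyticAt_of_pos hs hT hmean hpos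
    refine hU _ ha.eventually_analyticAt fun σ hσ => ?_
    exact AnalyticAt.contDiffAt hσ |>.contDiffWithinAt
  · refine ⟨flatDatum, contDiff_const.sub contDiff_expNegInvGlue_sin, fun σ => ?_,
      integral_flatDatum, ?_⟩
    · simp [flatDatum]
    · rintro s T hs hT ⟨w, hw⟩
      exact not_analyticAt_flatDatum
        (hw.analyticAt_of_pos hs hT integral_flatDatum flatDatum_zero_pos)
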